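/- Let $X_1,X_2,\ldots$ be independent and identically distributed positive random variables whose common distribution has a density, and let $d\ge 0$. Define $$h^{(1)}(x_1,x_2;d)=\frac{|x_1-x_2|}{x_1+x_2}\,\mathbf 1(x_1+x_2>d),\qquad h^{(2)}(x_1,x_2;d)=\mathbf 1(x_1+x_2>d),$$ and for $l=1,2$ and $n\ge 2$ $$U_n^{(l)}(d)=\frac{2}{n(n-1)}\sum_{1\le i<j\le n}h^{(l)}(X_i,X_j;d),\qquad \theta^{(l)}_d=\mathbb E\big[h^{(l)}(X_1,X_2;d)\big],\qquad \mu_d=\theta_d^{(1)},\quad \nu_d=\theta_d^{(2)}.$$ Put $$\psi^{(l)}(x_1,x_2;d)=h^{(l)}(x_1,x_2;d)-\theta^{(l)}_d,\qquad \psi_1^{(l)}(x_1;d)=\mathbb E\big[\psi^{(l)}(x_1,X_2;d)\big],$$ $$\eta_1^{(l)}(d)=\mathbb E\Big[\big(\psi_1^{(l)}(X_1;d)\big)^2\Big]\ (l=1,2),\qquad \eta_1^{(1,2)}(d)=\mathbb E\big[\psi_1^{(1)}(X_1;d)\,\psi_1^{(2)}(X_1;d)\big],$$ $$\Sigma_d=\begin{pmatrix}\eta_1^{(1)}(d)&\eta_1^{(1,2)}(d)\\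 \eta_1^{(1,2)}(d)&\eta_1^{(2)}(d)\end{pmatrix}.$$ If $\eta_1^{(l)}(d)>0$ for $l=1,2$, then $\Sigma_d$ is positive semidefinite and, as $n\to\infty$, $$\sqrt n\left(\begin{pmatrix}U_n^{(1)}(d)\\ U_n^{(2)}(d)\end{pmatrix}-\begin{pmatrix}\mu_d\\ \nu_d\end{pmatrix}\right)\xrightarrow{\ \mathcal D\ }N_2(\mathbf 0,4\Sigma_d).$$ -/

import Mathlib

open MeasureTheory ProbabilityTheory Filter

noncomputable section

namespace GammaTail

/-- The kernel `h⁽¹⁾(x₁, x₂; d) = |x₁ - x₂| / (x₁ + x₂) · 1(x₁ + x₂ > d)`. -/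
def kernel₁ (d x₁ x₂ : ℝ) : ℝ :=
  |x₁ - x₂| / (x₁ + x₂) * (if x₁ + x₂ > d then 1 else 0)

/-- The kernel `h⁽²⁾(x₁, x₂; d) = 1(x₁ + x₂ > d)`. -/
def kernel₂ (d x₁ x₂ : ℝ) : ℝ :=
  if x₁ + x₂ > d then 1 else 0

/-- The U-statistic of degree two `2 / (n (n - 1)) · ∑_{i < j} h(xᵢ, xⱼ)` of the sample
`x 0, …, x (n - 1)`. -/
def uStat (h : ℝ → ℝ → ℝ) (x : ℕ → ℝ) (n : ℕ) : ℝ :=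
  2 / ((n : ℝ) * ((n : ℝ) - 1)) *
    ∑ j ∈ Finset.range n, ∑ i ∈ Finset.range j, h (x i) (x j)

variable {Ω : Type*} [MeasurableSpace Ω]

/-- The mean `θ = E[h(X₁, X₂)]`; the first two variables of the sequence are `X 0` and `X 1`. -/
def theta (P : Measure Ω) (X : ℕ → Ω → ℝ) (h : ℝ → ℝ → ℝ) : ℝ :=
  ∫ ω, h (X 0 ω) (X 1 ω) ∂P

/-- The centred kernel `ψ(x₁, x₂) = h(x₁, x₂) - θ`. -/
def psi (P : Measure Ω) (X : ℕ → Ω → ℝ) (h : ℝ → ℝ → ℝ) (x₁ x₂ : ℝ) : ℝ :=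
  h x₁ x₂ - theta P X h

/-- The first-order projection `ψ₁(x₁) = E[ψ(x₁, X₂)]`. -/
def psiOne (P : Measure Ω) (X : ℕ → Ω → ℝ) (h : ℝ → ℝ → ℝ) (x₁ : ℝ) : ℝ :=
  ∫ ω, psi P X h x₁ (X 1 ω) ∂P

/-- `η₁ = E[ψ₁(X₁)²]`. -/
def eta (P : Measure Ω) (X : ℕ → Ω → ℝ) (h : ℝ → ℝ → ℝ) : ℝ :=
  ∫ ω, (psiOne P X h (X 0 ω)) ^ 2 ∂P

/-- `η₁⁽¹'²⁾ = E[ψ₁⁽¹⁾(X₁) ψ₁⁽²⁾(X₁)]`. -/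
def etaCross (P : Measure Ω) (X : ℕ → Ω → ℝ) (h k : ℝ → ℝ → ℝ) : ℝ :=
  ∫ ω, psiOne P X h (X 0 ω) * psiOne P X k (X 0 ω) ∂P

/-- The covariance matrix `Σ_d` of the first-order projections. -/
def sigmaMatrix (P : Measure Ω) (X : ℕ → Ω → ℝ) (d : ℝ) : Matrix (Fin 2) (Fin 2) ℝ :=
  !![eta P X (kernel₁ d), etaCross P X (kernel₁ d) (kernel₂ d);
     etaCross P X (kernel₁ d) (kernel₂ d), eta P X (kernel₂ d)]

end GammaTail

end

namespace GammaTail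

open scoped Topology

/-! Hoeffding's decomposition writes `U_n - θ = (2/n) ∑ ψ₁(X_i) + U_n(r)`, where the remainder
kernel `r` is degenerate: integrating out either argument gives zero. Products of `r` over two
distinct pairs therefore have mean zero, so the sum of `r` over all pairs has second moment `O(n²)`,
and `√n U_n(r) → 0` in probability by Markov. The classical CLT for `2 ψ₁(X_i)` and Slutsky's lemma
then give the scalar limit `N(0, 4η)`, `tendstoInDistribution_uStat`.

The joint limit follows by Cramér–Wold: a combination `t₀ h + t₁ k` is again a bounded symmetric
kernel, and its `eta` is the quadratic form of the covariance matrix (`eta_linear`), which also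
yields positive semidefiniteness.

These results need kernels bounded on the whole plane, whereas `kernel₁` is bounded only for
nonnegative arguments. They are applied to `kernel₁ d |x| |y|` and transferred back using almost
sure positivity. -/

/-- A bounded measurable function of two independent variables has mean zero if it does so after
integrating out the first variable. -/
lemma integral_comp_eq_zero_of_indepFun {Ω E : Type*} [MeasurableSpace Ω] [MeasurableSpace E]
    {P : Measure Ω} [IsProbabilityMeasure P] {Y : Ω → ℝ} {Z : Ω → E} (hY : Measurable Y)
    (hZ : Measurable Z) (hind : IndepFun Y Z P) {f : ℝ × E → ℝ} (hf : Measurable f) {C : ℝ}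
    (hC : ∀ p, |f p| ≤ C) (h0 : ∀ z, ∫ ω, f (Y ω, z) ∂P = 0) :
    ∫ ω, f (Y ω, Z ω) ∂P = 0 := by
  have := Measure.isProbabilityMeasure_map (μ := P) hY.aemeasurable
  have := Measure.isProbabilityMeasure_map (μ := P) hZ.aemeasurable
  have hmap := (indepFun_iff_map_prod_eq_prod_map_map hY.aemeasurable hZ.aemeasurable).1 hind
  have hint : Integrable f ((P.map Y).prod (P.map Z)) :=
    Integrable.of_bound hf.aestronglyMeasurable C (ae_of_all _ hC)
  rw [← integral_map (φ := fun ω => (Y ω, Z ω)) (hY.prodMk hZ).aemeasurable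
    hf.aestronglyMeasurable, hmap, integral_prod_symm _ hint]
  refine integral_eq_zero_of_ae (ae_of_all _ fun z => ?_)
  simp only [Pi.zero_apply]
  rw [integral_map hY.aemeasurable (f := fun y => f (y, z))
    (hf.comp measurable_prodMk_right).aestronglyMeasurable]
  exact h0 z

variable {Ω : Type*} [MeasurableSpace Ω] {P : Measure Ω}
  {X : ℕ → Ω → ℝ} {h k : ℝ → ℝ → ℝ} {C : ℝ}

/-- The indices `a, b, c` may coincide with one another; two pairs sharing an index require this. -/
lemma indepFun_triple (hmeas : ∀ i, Measurable (X i)) (hindep : iIndepFun X P) {i a b c : ℕ}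
    (ha : i ≠ a) (hb : i ≠ b) (hc : i ≠ c) :
    IndepFun (X i) (fun ω => (X a ω, X b ω, X c ω)) P := by
  have hd : Disjoint ({i} : Finset ℕ) {a, b, c} := by simp [ha, hb, hc]
  have := hindep.indepFun_finset _ _ hd hmeas
  exact this.comp (φ := fun f : ({i} : Finset ℕ) → ℝ => f ⟨i, by simp⟩)
    (ψ := fun f : ({a, b, c} : Finset ℕ) → ℝ =>
      (f ⟨a, by simp⟩, f ⟨b, by simp⟩, f ⟨c, by simp⟩)) (by fun_prop) (by fun_prop)

lemma integral_comp_eq_of_identDistrib (hident : ∀ i, IdentDistrib (X i) (X 0) P P)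
    {f : ℝ → ℝ} (hf : Measurable f) (i j : ℕ) :
    ∫ ω, f (X i ω) ∂P = ∫ ω, f (X j ω) ∂P :=
  (((hident i).trans (hident j).symm).comp hf).integral_eq

/-! ### Hoeffding decomposition -/

/-- The degenerate part of the kernel in the Hoeffding decomposition. -/
noncomputable def remainder (P : Measure Ω) (X : ℕ → Ω → ℝ)
    (h : ℝ → ℝ → ℝ) (x y : ℝ) : ℝ :=
  h x y - theta P X h - psiOne P X h x - psiOne P X h y

lemma remainder_symm (hsymm : ∀ x y, h x y = h y x) (x y : ℝ) :
    remainder P X h x y = remainder P X h y x := by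
  simp only [remainder, hsymm x y]; ring

/-- Each index below `n` lies in exactly `n - 1` pairs. -/
lemma sum_pairs_add (f : ℕ → ℝ) (n : ℕ) :
    ∑ j ∈ Finset.range n, ∑ i ∈ Finset.range j, (f i + f j) =
      ((n : ℝ) - 1) * ∑ i ∈ Finset.range n, f i := by
  induction n with
  | zero => simp
  | succ n ih =>
    rw [Finset.sum_range_succ, ih, Finset.sum_add_distrib, Finset.sum_range_succ]
    simp only [Finset.sum_const, Finset.card_range, nsmul_eq_mul]
    push_cast
    ring

/-- Hoeffding decomposition of a U-statistic of degree two. -/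
lemma uStat_sub_theta (x : ℕ → ℝ) {n : ℕ} (hn : 2 ≤ n) :
    uStat h x n - theta P X h =
      2 / n * ∑ i ∈ Finset.range n, psiOne P X h (x i) + uStat (remainder P X h) x n := by
  have hn2 : (2 : ℝ) ≤ n := by exact_mod_cast hn
  have hn1 : (n : ℝ) - 1 ≠ 0 := by linarith
  have hn0 : (n : ℝ) ≠ 0 := by linarith
  -- Half of `theta` at each index contributes one `theta` per pair.
  have hcst := sum_pairs_add (fun _ => theta P X h / 2) n
  have hproj := sum_pairs_add (fun i => psiOne P X h (x i)) n
  rw [Finset.sum_const, Finset.card_range, nsmul_eq_mul] at hcst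
  have hdec : ∑ j ∈ Finset.range n, ∑ i ∈ Finset.range j, h (x i) (x j) =
      ∑ j ∈ Finset.range n, ∑ i ∈ Finset.range j, remainder P X h (x i) (x j) +
        (((n : ℝ) - 1) * ∑ i ∈ Finset.range n, psiOne P X h (x i) +
          ((n : ℝ) - 1) * (n * (theta P X h / 2))) := by
    rw [← hproj, ← hcst]
    simp only [← Finset.sum_add_distrib]
    refine Finset.sum_congr rfl fun j _ => Finset.sum_congr rfl fun i _ => ?_
    rw [remainder]
    ring
  rw [uStat, uStat, hdec]
  field_simp
  ring

variable [IsProbabilityMeasure P]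

/-! ### Degenerate kernels: orthogonality and negligibility -/

section Orthogonality

variable {r : ℝ → ℝ → ℝ}

/-- With the other variables frozen, the second factor is constant and the first integrates to zero
over `X i`. -/
lemma integral_mul_eq_zero_of_degenerate (hmeas : ∀ i, Measurable (X i)) (hindep : iIndepFun X P)
    (hr : Measurable (Function.uncurry r)) (hC : ∀ x y, |r x y| ≤ C)
    (h0 : ∀ i x, ∫ ω, r (X i ω) x ∂P = 0) {i a b c : ℕ}
    (ha : i ≠ a) (hb : i ≠ b) (hc : i ≠ c) :
    ∫ ω, r (X i ω) (X a ω) * r (X b ω) (X c ω) ∂P = 0 := by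
  refine integral_comp_eq_zero_of_indepFun (hmeas i)
    ((hmeas a).prodMk ((hmeas b).prodMk (hmeas c))) (indepFun_triple hmeas hindep ha hb hc)
    (f := fun p => r p.1 p.2.1 * r p.2.2.1 p.2.2.2) (C := C * C) ?_ ?_ ?_
  · exact (hr.comp (f := fun p : ℝ × ℝ × ℝ × ℝ => (p.1, p.2.1)) (by fun_prop)).mul
      (hr.comp (f := fun p : ℝ × ℝ × ℝ × ℝ => (p.2.2.1, p.2.2.2)) (by fun_prop))
  · intro p
    rw [abs_mul]
    exact mul_le_mul (hC _ _) (hC _ _) (abs_nonneg _) ((abs_nonneg _).trans (hC 0 0))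
  · intro z
    simp only [integral_mul_const, h0, zero_mul]

/-- The second moment of the sum of a bounded degenerate symmetric kernel over the pairs of a
sample grows at most quadratically. -/
lemma integral_sq_sum_pairs_le (hmeas : ∀ i, Measurable (X i)) (hindep : iIndepFun X P)
    (hr : Measurable (Function.uncurry r)) (hsymm : ∀ x y, r x y = r y x)
    (hC : ∀ x y, |r x y| ≤ C) (h0 : ∀ i x, ∫ ω, r (X i ω) x ∂P = 0) (n : ℕ) :
    ∫ ω, (∑ j ∈ Finset.range n, ∑ i ∈ Finset.range j, r (X i ω) (X j ω)) ^ 2 ∂P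
      ≤ n * (n - 1) / 2 * C ^ 2 := by
  have hrm (i j : ℕ) : Measurable fun ω => r (X i ω) (X j ω) :=
    hr.comp ((hmeas i).prodMk (hmeas j))
  have hC0 : 0 ≤ C := (abs_nonneg _).trans (hC 0 0)
  have hint (i j a b : ℕ) : Integrable (fun ω => r (X i ω) (X j ω) * r (X a ω) (X b ω)) P := by
    refine Integrable.of_bound ((hrm i j).mul (hrm a b)).aestronglyMeasurable (C * C)
      (ae_of_all _ fun ω => ?_)
    rw [Real.norm_eq_abs, abs_mul]
    exact mul_le_mul (hC _ _) (hC _ _) (abs_nonneg _) hC0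
  set s : Finset ((_ : ℕ) × ℕ) := (Finset.range n).sigma fun j => Finset.range j with hs
  have hsum (ω : Ω) : (∑ j ∈ Finset.range n, ∑ i ∈ Finset.range j, r (X i ω) (X j ω)) ^ 2 =
      ∑ p ∈ s, ∑ q ∈ s, r (X p.2 ω) (X p.1 ω) * r (X q.2 ω) (X q.1 ω) := by
    rw [← Finset.sum_mul_sum, ← sq, hs, Finset.sum_sigma]
  have hcross : ∀ p ∈ s, ∀ q ∈ s, q ≠ p →
      ∫ ω, r (X p.2 ω) (X p.1 ω) * r (X q.2 ω) (X q.1 ω) ∂P = 0 := by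
    rintro ⟨j, i⟩ hp ⟨l, m⟩ hq hne
    simp only [hs, Finset.mem_sigma, Finset.mem_range] at hp hq ⊢
    -- Some index occurs exactly once among the two pairs: the larger of the top indices if they
    -- differ, otherwise a bottom index. Symmetry moves it to the first slot.
    rcases lt_trichotomy j l with hjl | rfl | hjl
    · simp_rw [mul_comm (r (X i _) _), hsymm (X m _)]
      exact integral_mul_eq_zero_of_degenerate hmeas hindep hr hC h0
        (by omega) (by omega) (by omega)
    · have : i ≠ m := fun e => hne (by simp [e])
      exact integral_mul_eq_zero_of_degenerate hmeas hindep hr hC h0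
        (by omega) (by omega) (by omega)
    · simp_rw [hsymm (X i _)]
      exact integral_mul_eq_zero_of_degenerate hmeas hindep hr hC h0
        (by omega) (by omega) (by omega)
  have hcard : (s.card : ℝ) = n * (n - 1) / 2 := by
    rw [hs, Finset.card_sigma]
    simp only [Finset.card_range]
    rw [eq_div_iff two_ne_zero]
    have := Finset.sum_range_id_mul_two n
    cases n with
    | zero => simp
    | succ n =>
      have h2 : ((∑ i ∈ Finset.range (n + 1), i : ℕ) : ℝ) * 2 = ((n + 1) * n : ℕ) := by
        exact_mod_cast this
      rw [h2]; push_cast; ring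
  simp_rw [hsum]
  rw [integral_finsetSum _ fun p _ => integrable_finsetSum _ fun q _ => hint _ _ _ _, ← hcard,
    ← nsmul_eq_mul]
  refine Finset.sum_le_card_nsmul _ _ _ fun p hp => ?_
  rw [integral_finsetSum _ fun q _ => hint _ _ _ _,
    Finset.sum_eq_single_of_mem p hp (hcross p hp)]
  refine (integral_mono (hint _ _ _ _) (integrable_const (C ^ 2)) fun ω => ?_).trans (by simp)
  simp only [← sq]
  exact sq_le_sq' (by linarith [abs_le.1 (hC (X p.2 ω) (X p.1 ω))]) (abs_le.1 (hC _ _)).2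

/-- Markov's inequality for the square: the factor `4 / (n (n - 1)²)` times the second moment bound
`n (n - 1) / 2 * C²` leaves `2 C² / (n - 1)`. -/
lemma tendstoInMeasure_sqrt_mul_uStat_of_degenerate (hmeas : ∀ i, Measurable (X i))
    (hindep : iIndepFun X P)
    (hr : Measurable (Function.uncurry r)) (hsymm : ∀ x y, r x y = r y x)
    (hC : ∀ x y, |r x y| ≤ C) (h0 : ∀ i x, ∫ ω, r (X i ω) x ∂P = 0) :
    TendstoInMeasure P (fun (n : ℕ) ω => √n * uStat r (fun i => X i ω) n) atTop 0 := by
  rw [tendstoInMeasure_iff_measureReal_norm]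
  intro ε hε
  simp only [Pi.zero_apply, sub_zero, Real.norm_eq_abs]
  have hlim : Tendsto (fun n : ℕ => 2 * C ^ 2 / ε ^ 2 * ((n : ℝ) - 1)⁻¹) atTop (𝓝 0) := by
    have := (tendsto_inv_atTop_zero.comp (tendsto_atTop_add_const_right atTop (-1 : ℝ)
      tendsto_natCast_atTop_atTop)).const_mul (2 * C ^ 2 / ε ^ 2)
    simpa only [mul_zero, sub_eq_add_neg, Function.comp_apply] using this
  refine squeeze_zero' (.of_forall fun n => measureReal_nonneg) ?_ hlim
  filter_upwards [eventually_ge_atTop 2] with n hn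
  have hn2 : (2 : ℝ) ≤ n := by exact_mod_cast hn
  have hC0 : 0 ≤ C := (abs_nonneg _).trans (hC 0 0)
  set S : Ω → ℝ := fun ω => ∑ j ∈ Finset.range n, ∑ i ∈ Finset.range j, r (X i ω) (X j ω)
  have hSm : Measurable S := Finset.measurable_sum _ fun j _ => Finset.measurable_sum _ fun i _ =>
    hr.comp ((hmeas i).prodMk (hmeas j))
  have hSb (ω : Ω) : |S ω| ≤ ∑ j ∈ Finset.range n, ∑ i ∈ Finset.range j, C :=
    (Finset.abs_sum_le_sum_abs _ _).trans <| Finset.sum_le_sum fun j _ =>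
      (Finset.abs_sum_le_sum_abs _ _).trans <| Finset.sum_le_sum fun i _ => hC _ _
  have hSi : Integrable (fun ω => S ω ^ 2) P := by
    refine Integrable.of_bound (hSm.pow_const 2).aestronglyMeasurable
      ((∑ j ∈ Finset.range n, ∑ i ∈ Finset.range j, C) ^ 2) (ae_of_all _ fun ω => ?_)
    rw [Real.norm_eq_abs, abs_pow]
    exact pow_le_pow_left₀ (abs_nonneg _) (hSb ω) 2
  have hsq (ω : Ω) : (√n * uStat r (fun i => X i ω) n) ^ 2 =
      4 / (n * ((n : ℝ) - 1) ^ 2) * S ω ^ 2 := by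
    have : (n : ℝ) - 1 ≠ 0 := by linarith
    rw [mul_pow, Real.sq_sqrt (by positivity), uStat]
    change (n : ℝ) * (2 / (n * ((n : ℝ) - 1)) * S ω) ^ 2 = _
    field_simp
    ring
  have hset : {ω | ε ≤ |√n * uStat r (fun i => X i ω) n|} =
      {ω | ε ^ 2 ≤ 4 / (n * ((n : ℝ) - 1) ^ 2) * S ω ^ 2} := by
    ext ω
    simp only [Set.mem_ofPred_eq, ← hsq]
    rw [← sq_abs (_ * _)]
    exact (sq_le_sq₀ hε.le (abs_nonneg _)).symm
  rw [hset]
  have hmarkov := mul_meas_ge_le_integral_of_nonneg (μ := P)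
    (f := fun ω => 4 / (n * ((n : ℝ) - 1) ^ 2) * S ω ^ 2)
    (ae_of_all _ fun ω => by positivity) (hSi.const_mul _) (ε ^ 2)
  rw [integral_const_mul] at hmarkov
  have hS2 := integral_sq_sum_pairs_le hmeas hindep hr hsymm hC h0 n
  have hle : ε ^ 2 * P.real {ω | ε ^ 2 ≤ 4 / (n * ((n : ℝ) - 1) ^ 2) * S ω ^ 2} ≤
      2 * C ^ 2 * ((n : ℝ) - 1)⁻¹ := by
    refine hmarkov.trans ((mul_le_mul_of_nonneg_left hS2 (by positivity)).trans_eq ?_)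
    have : (n : ℝ) - 1 ≠ 0 := by linarith
    field_simp
    ring
  rw [div_mul_eq_mul_div, le_div_iff₀ (by positivity), mul_comm]
  exact hle

end Orthogonality

/-! ### First-order projection and degeneracy of the remainder -/

section Projection

lemma integrable_kernel (hmeas : ∀ i, Measurable (X i)) (hh : Measurable (Function.uncurry h))
    (hC : ∀ x y, |h x y| ≤ C) (x : ℝ) (i : ℕ) : Integrable (fun ω => h x (X i ω)) P :=
  Integrable.of_bound (hh.comp (measurable_const.prodMk (hmeas i))).aestronglyMeasurable C
    (ae_of_all _ fun _ => hC _ _)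

lemma integrable_kernel_pair (hmeas : ∀ i, Measurable (X i))
    (hh : Measurable (Function.uncurry h)) (hC : ∀ x y, |h x y| ≤ C) (i j : ℕ) :
    Integrable (fun ω => h (X i ω) (X j ω)) P :=
  Integrable.of_bound (hh.comp ((hmeas i).prodMk (hmeas j))).aestronglyMeasurable C
    (ae_of_all _ fun _ => hC _ _)

lemma psiOne_eq (hmeas : ∀ i, Measurable (X i)) (hh : Measurable (Function.uncurry h))
    (hC : ∀ x y, |h x y| ≤ C) (x : ℝ) :
    psiOne P X h x = ∫ ω, h x (X 1 ω) ∂P - theta P X h := by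
  simp only [psiOne, psi]
  rw [integral_sub (integrable_kernel hmeas hh hC x 1) (integrable_const _)]
  simp

lemma measurable_psiOne (hmeas : ∀ i, Measurable (X i)) (hh : Measurable (Function.uncurry h)) :
    Measurable (psiOne P X h) := by
  have : Measurable (Function.uncurry fun x ω => psi P X h x (X 1 ω)) :=
    (hh.comp (measurable_fst.prodMk ((hmeas 1).comp measurable_snd))).sub_const _
  exact this.stronglyMeasurable.integral_prod_right.measurable

lemma abs_theta_le (hC : ∀ x y, |h x y| ≤ C) : |theta P X h| ≤ C := by
  simpa [theta] using norm_integral_le_of_norm_le_const (μ := P) (f := fun ω => h (X 0 ω) (X 1 ω))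
    (ae_of_all _ fun _ => hC _ _)

lemma abs_psiOne_le (hC : ∀ x y, |h x y| ≤ C) (x : ℝ) : |psiOne P X h x| ≤ 2 * C := by
  simpa [psiOne] using norm_integral_le_of_norm_le_const (μ := P) (f := fun ω => psi P X h x (X 1 ω))
    (C := 2 * C) (ae_of_all _ fun ω => (abs_sub _ _).trans <| by
      linarith [hC x (X 1 ω), abs_theta_le (P := P) (X := X) hC])

/-- By Fubini, `h(X₀, X₁) - θ - ψ₁(X₀)` has mean zero, since it does over `X₁` for each frozen value
of `X₀`; and `h(X₀, X₁)` has mean `θ`. -/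
lemma integral_psiOne (hmeas : ∀ i, Measurable (X i)) (hindep : iIndepFun X P)
    (hident : ∀ i, IdentDistrib (X i) (X 0) P P)
    (hh : Measurable (Function.uncurry h)) (hC : ∀ x y, |h x y| ≤ C) (i : ℕ) :
    ∫ ω, psiOne P X h (X i ω) ∂P = 0 := by
  have hg := measurable_psiOne (P := P) hmeas hh
  have hgi : Integrable (fun ω => psiOne P X h (X 0 ω)) P :=
    Integrable.of_bound (hg.comp (hmeas 0)).aestronglyMeasurable (2 * C)
      (ae_of_all _ fun _ => abs_psiOne_le hC _)
  rw [integral_comp_eq_of_identDistrib hident hg i 0]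
  have key := integral_comp_eq_zero_of_indepFun (hmeas 1) (hmeas 0)
    (hindep.indepFun one_ne_zero) (C := C + C + 2 * C)
    (f := fun p => h p.2 p.1 - theta P X h - psiOne P X h p.2) ?_ ?_ ?_
  · simp only at key
    have hsub : Integrable (fun ω => h (X 0 ω) (X 1 ω) - theta P X h) P :=
      (integrable_kernel_pair hmeas hh hC 0 1).sub (integrable_const _)
    rw [integral_sub hsub hgi, integral_sub (integrable_kernel_pair hmeas hh hC 0 1) (integrable_const _)] at key
    simp only [integral_const, probReal_univ, one_smul] at key
    have : ∫ ω, h (X 0 ω) (X 1 ω) ∂P = theta P X h := rfl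
    linarith
  · exact ((hh.comp measurable_swap).sub_const _).sub (hg.comp measurable_snd)
  · intro p
    have h1 := hC p.2 p.1
    have h2 := abs_theta_le (P := P) (X := X) hC
    have h3 := abs_psiOne_le (P := P) (X := X) hC p.2
    rw [abs_le] at *
    constructor <;> linarith
  · intro x
    simp only
    have hsub : Integrable (fun ω => h x (X 1 ω) - theta P X h) P :=
      (integrable_kernel hmeas hh hC x 1).sub (integrable_const _)
    rw [integral_sub hsub (integrable_const _),
      integral_sub (integrable_kernel hmeas hh hC x 1) (integrable_const _),
      psiOne_eq hmeas hh hC]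
    simp

lemma measurable_remainder (hmeas : ∀ i, Measurable (X i))
    (hh : Measurable (Function.uncurry h)) :
    Measurable (Function.uncurry (remainder P X h)) := by
  have hg := measurable_psiOne (P := P) hmeas hh
  exact ((hh.sub_const _).sub (hg.comp measurable_fst)).sub (hg.comp measurable_snd)

lemma abs_remainder_le (hC : ∀ x y, |h x y| ≤ C) (x y : ℝ) : |remainder P X h x y| ≤ 6 * C := by
  have h1 := hC x y
  have h2 := abs_theta_le (P := P) (X := X) hC
  have h3 := abs_psiOne_le (P := P) (X := X) hC x
  have h4 := abs_psiOne_le (P := P) (X := X) hC y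
  rw [remainder]
  rw [abs_le] at *
  constructor <;> linarith

/-- For frozen `x`, the mean of `h(x, X_i) - θ` is `ψ₁(x)`, while `ψ₁(X_i)` is centred. -/
lemma integral_remainder (hmeas : ∀ i, Measurable (X i)) (hindep : iIndepFun X P)
    (hident : ∀ i, IdentDistrib (X i) (X 0) P P)
    (hh : Measurable (Function.uncurry h)) (hsymm : ∀ x y, h x y = h y x)
    (hC : ∀ x y, |h x y| ≤ C) (i : ℕ) (x : ℝ) :
    ∫ ω, remainder P X h (X i ω) x ∂P = 0 := by
  have hg := measurable_psiOne (P := P) hmeas hh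
  have hgi : Integrable (fun ω => psiOne P X h (X i ω)) P :=
    Integrable.of_bound (hg.comp (hmeas i)).aestronglyMeasurable (2 * C)
      (ae_of_all _ fun _ => abs_psiOne_le hC _)
  have hi := integrable_kernel (P := P) hmeas hh hC x i
  have hone : ∫ ω, h x (X i ω) ∂P = ∫ ω, h x (X 1 ω) ∂P :=
    integral_comp_eq_of_identDistrib hident (f := h x)
      (hh.comp (measurable_const.prodMk measurable_id)) i 1
  simp only [remainder, hsymm _ x]
  have hi' : Integrable (fun ω => h x (X i ω) - theta P X h) P := hi.sub (integrable_const _)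
  have hi'' : Integrable (fun ω => h x (X i ω) - theta P X h - psiOne P X h (X i ω)) P :=
    hi'.sub hgi
  rw [integral_sub hi'' (integrable_const _), integral_sub hi' hgi, integral_sub hi (integrable_const _),
    integral_psiOne hmeas hindep hident hh hC, psiOne_eq hmeas hh hC, hone]
  simp

end Projection
-- Scalar central limit theorem
section CentralLimit

variable {Ω : Type*} [MeasurableSpace Ω] {P : Measure Ω} [IsProbabilityMeasure P]
  {X : ℕ → Ω → ℝ} {h k : ℝ → ℝ → ℝ} {C : ℝ}

lemma measurable_uStat (hmeas : ∀ i, Measurable (X i)) (hh : Measurable (Function.uncurry h))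
    (n : ℕ) : Measurable fun ω => uStat h (fun i => X i ω) n :=
  (Finset.measurable_sum _ fun j _ => Finset.measurable_sum _ fun i _ =>
    hh.comp ((hmeas i).prodMk (hmeas j))).const_mul _

/-- The central limit theorem for U-statistics of degree two with bounded symmetric kernel. -/
theorem tendstoInDistribution_uStat (hmeas : ∀ i, Measurable (X i)) (hindep : iIndepFun X P)
    (hident : ∀ i, IdentDistrib (X i) (X 0) P P)
    (hh : Measurable (Function.uncurry h)) (hsymm : ∀ x y, h x y = h y x)
    (hC : ∀ x y, |h x y| ≤ C) :
    TendstoInDistribution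
      (fun (n : ℕ) ω => √n * (uStat h (fun i => X i ω) n - theta P X h)) atTop
      (id : ℝ → ℝ) (fun _ => P) (gaussianReal 0 (4 * eta P X h).toNNReal) := by
  have hg := measurable_psiOne (P := P) hmeas hh
  have hu : Measurable fun x => 2 * psiOne P X h x := hg.const_mul 2
  have hmean : ∫ ω, 2 * psiOne P X h (X 0 ω) ∂P = 0 := by
    rw [integral_const_mul, integral_psiOne hmeas hindep hident hh hC, mul_zero]
  have hvar : Var[fun ω => 2 * psiOne P X h (X 0 ω); P] = 4 * eta P X h := by
    rw [variance_of_integral_eq_zero (X := fun ω => 2 * psiOne P X h (X 0 ω))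
      (hu.comp (hmeas 0)).aemeasurable hmean, eta,
      ← integral_const_mul]
    refine integral_congr_ae (ae_of_all _ fun ω => ?_)
    dsimp only
    ring
  -- The factor 2 sits inside the summands, so their variance is already `4 * eta`.
  have hclt := tendstoInDistribution_inv_sqrt_mul_sum_sub (P := P)
    (X := fun i ω => 2 * psiOne P X h (X i ω)) (Y := (id : ℝ → ℝ))
    (P' := gaussianReal 0 (4 * eta P X h).toNNReal) (by rw [hvar]; exact HasLaw.id)
    (MemLp.of_bound (hu.comp (hmeas 0)).aestronglyMeasurable (2 * (2 * C))
      (ae_of_all _ fun ω => by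
        rw [Real.norm_eq_abs, abs_mul, abs_two]
        exact mul_le_mul_of_nonneg_left (abs_psiOne_le hC _) zero_le_two))
    (hindep.comp (fun _ x => 2 * psiOne P X h x) fun _ => hu)
    fun i => (hident i).comp hu
  -- Slutsky: for `n ≥ 2` the difference from the CLT sum is exactly `√n` times the U-statistic of
  -- the remainder.
  refine tendstoInDistribution_of_tendstoInMeasure_sub _ _ hclt ?_ fun n =>
    (((measurable_uStat hmeas hh n).sub_const _).const_mul _).aemeasurable
  have hrem := tendstoInMeasure_sqrt_mul_uStat_of_degenerate hmeas hindep
    (measurable_remainder (P := P) hmeas hh) (remainder_symm hsymm) (abs_remainder_le hC)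
    (integral_remainder hmeas hindep hident hh hsymm hC)
  refine hrem.congr' ?_ (ae_eq_refl _)
  filter_upwards [eventually_ge_atTop 2] with n hn
  refine ae_of_all _ fun ω => ?_
  have hn0 : √(n : ℝ) ≠ 0 := by positivity
  have hnn : (n : ℝ) = √n * √n := (Real.mul_self_sqrt n.cast_nonneg).symm
  simp only [Pi.sub_apply, uStat_sub_theta (P := P) (X := X) (h := h) _ hn, hmean, mul_zero,
    sub_zero, ← Finset.mul_sum]
  generalize uStat _ _ _ = u
  generalize ∑ i ∈ Finset.range n, psiOne P X h (X i ω) = v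
  have : 2 / (n : ℝ) = 2 * (√n)⁻¹ * (√n)⁻¹ := by
    rw [div_eq_mul_inv]; nth_rw 1 [hnn]; rw [mul_inv]; ring
  rw [this]
  field_simp
  ring

end CentralLimit

/-! ### Joint limit by linear combinations of kernels -/

section CramerWold

variable {Ω : Type*} [MeasurableSpace Ω] {P : Measure Ω} [IsProbabilityMeasure P]
  {X : ℕ → Ω → ℝ} {h k : ℝ → ℝ → ℝ} {C D : ℝ}

lemma uStat_linear (a b : ℝ) (x : ℕ → ℝ) (n : ℕ) :
    uStat (fun y z => a * h y z + b * k y z) x n = a * uStat h x n + b * uStat k x n := by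
  simp only [uStat, Finset.sum_add_distrib, ← Finset.mul_sum]
  ring

lemma theta_linear (hmeas : ∀ i, Measurable (X i)) (hh : Measurable (Function.uncurry h))
    (hk : Measurable (Function.uncurry k)) (hC : ∀ x y, |h x y| ≤ C) (hD : ∀ x y, |k x y| ≤ D)
    (a b : ℝ) :
    theta P X (fun y z => a * h y z + b * k y z) = a * theta P X h + b * theta P X k := by
  simp only [theta]
  rw [integral_add ((integrable_kernel_pair hmeas hh hC 0 1).const_mul a)
    ((integrable_kernel_pair hmeas hk hD 0 1).const_mul b), integral_const_mul, integral_const_mul]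

lemma measurable_linear (hh : Measurable (Function.uncurry h))
    (hk : Measurable (Function.uncurry k)) (a b : ℝ) :
    Measurable (Function.uncurry fun y z => a * h y z + b * k y z) :=
  (hh.const_mul a).add (hk.const_mul b)

lemma abs_linear_le (hC : ∀ x y, |h x y| ≤ C) (hD : ∀ x y, |k x y| ≤ D) (a b x y : ℝ) :
    |a * h x y + b * k x y| ≤ |a| * C + |b| * D := by
  refine (abs_add_le _ _).trans ?_
  rw [abs_mul, abs_mul]
  gcongr
  exacts [hC x y, hD x y]

lemma psiOne_linear (hmeas : ∀ i, Measurable (X i)) (hh : Measurable (Function.uncurry h))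
    (hk : Measurable (Function.uncurry k)) (hC : ∀ x y, |h x y| ≤ C) (hD : ∀ x y, |k x y| ≤ D)
    (a b x : ℝ) :
    psiOne P X (fun y z => a * h y z + b * k y z) x =
      a * psiOne P X h x + b * psiOne P X k x := by
  rw [psiOne_eq hmeas (measurable_linear hh hk a b) (abs_linear_le hC hD a b),
    psiOne_eq hmeas hh hC, psiOne_eq hmeas hk hD, theta_linear hmeas hh hk hC hD,
    integral_add ((integrable_kernel hmeas hh hC x 1).const_mul a)
      ((integrable_kernel hmeas hk hD x 1).const_mul b), integral_const_mul, integral_const_mul]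
  ring

lemma integrable_psiOne_mul (hmeas : ∀ i, Measurable (X i)) (hh : Measurable (Function.uncurry h))
    (hk : Measurable (Function.uncurry k)) (hC : ∀ x y, |h x y| ≤ C) (hD : ∀ x y, |k x y| ≤ D) :
    Integrable (fun ω => psiOne P X h (X 0 ω) * psiOne P X k (X 0 ω)) P := by
  refine Integrable.of_bound (((measurable_psiOne hmeas hh).comp (hmeas 0)).mul
    ((measurable_psiOne hmeas hk).comp (hmeas 0))).aestronglyMeasurable (2 * C * (2 * D))
    (ae_of_all _ fun ω => ?_)
  rw [Real.norm_eq_abs, abs_mul]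
  exact mul_le_mul (abs_psiOne_le hC _) (abs_psiOne_le hD _) (abs_nonneg _)
    ((abs_nonneg _).trans (abs_psiOne_le (P := P) (X := X) hC 0))

/-- The covariance matrix of the first-order projections of two kernels. -/
noncomputable def covMatrix (P : Measure Ω) (X : ℕ → Ω → ℝ) (h k : ℝ → ℝ → ℝ) :
    Matrix (Fin 2) (Fin 2) ℝ :=
  !![eta P X h, etaCross P X h k; etaCross P X h k, eta P X k]

open Matrix in
-- `psiOne` is linear in the kernel, so the square expands into the covariance entries.
lemma eta_linear (hmeas : ∀ i, Measurable (X i)) (hh : Measurable (Function.uncurry h))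
    (hk : Measurable (Function.uncurry k)) (hC : ∀ x y, |h x y| ≤ C) (hD : ∀ x y, |k x y| ≤ D)
    (t : Fin 2 → ℝ) :
    eta P X (fun y z => t 0 * h y z + t 1 * k y z) = t ⬝ᵥ covMatrix P X h k *ᵥ t := by
  have e (ω : Ω) : psiOne P X (fun y z => t 0 * h y z + t 1 * k y z) (X 0 ω) ^ 2 =
      t 0 ^ 2 * (psiOne P X h (X 0 ω) * psiOne P X h (X 0 ω)) +
      2 * t 0 * t 1 * (psiOne P X h (X 0 ω) * psiOne P X k (X 0 ω)) +
      t 1 ^ 2 * (psiOne P X k (X 0 ω) * psiOne P X k (X 0 ω)) := by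
    rw [psiOne_linear hmeas hh hk hC hD]
    ring
  have h11 := (integrable_psiOne_mul (P := P) hmeas hh hh hC hC).const_mul (t 0 ^ 2)
  have h12 := (integrable_psiOne_mul (P := P) hmeas hh hk hC hD).const_mul (2 * t 0 * t 1)
  have h22 := (integrable_psiOne_mul (P := P) hmeas hk hk hD hD).const_mul (t 1 ^ 2)
  rw [eta]
  simp only [e]
  have h112 : Integrable (fun ω => t 0 ^ 2 * (psiOne P X h (X 0 ω) * psiOne P X h (X 0 ω)) +
      2 * t 0 * t 1 * (psiOne P X h (X 0 ω) * psiOne P X k (X 0 ω))) P := h11.add h12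
  rw [integral_add h112 h22, integral_add h11 h12, integral_const_mul,
    integral_const_mul, integral_const_mul]
  simp [covMatrix, eta, etaCross, sq, dotProduct, mulVec, Fin.sum_univ_two]
  ring

lemma posSemidef_covMatrix (hmeas : ∀ i, Measurable (X i)) (hh : Measurable (Function.uncurry h))
    (hk : Measurable (Function.uncurry k)) (hC : ∀ x y, |h x y| ≤ C) (hD : ∀ x y, |k x y| ≤ D) :
    (covMatrix P X h k).PosSemidef := by
  refine Matrix.PosSemidef.of_dotProduct_mulVec_nonneg ?_ fun t => ?_
  · ext i j
    fin_cases i <;> fin_cases j <;> simp [covMatrix]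
  · rw [star_trivial, ← eta_linear hmeas hh hk hC hD]
    exact integral_nonneg fun ω => sq_nonneg _

/-- The joint central limit theorem for two U-statistics of degree two with bounded symmetric
kernels. -/
theorem tendstoInDistribution_uStat_pair (hmeas : ∀ i, Measurable (X i)) (hindep : iIndepFun X P)
    (hident : ∀ i, IdentDistrib (X i) (X 0) P P)
    (hh : Measurable (Function.uncurry h)) (hk : Measurable (Function.uncurry k))
    (hsymm : ∀ x y, h x y = h y x) (ksymm : ∀ x y, k x y = k y x)
    (hC : ∀ x y, |h x y| ≤ C) (hD : ∀ x y, |k x y| ≤ D) :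
    TendstoInDistribution
      (fun (n : ℕ) ω => √n •
        (!₂[uStat h (fun i => X i ω) n, uStat k (fun i => X i ω) n] -
          !₂[theta P X h, theta P X k]))
      atTop (id : EuclideanSpace ℝ (Fin 2) → EuclideanSpace ℝ (Fin 2)) (fun _ => P)
      (multivariateGaussian 0 ((4 : ℝ) • covMatrix P X h k)) := by
  have hS : ((4 : ℝ) • covMatrix P X h k).PosSemidef :=
    (posSemidef_covMatrix hmeas hh hk hC hD).smul (by norm_num)
  have hVm (n : ℕ) : Measurable fun ω => √n •
      (!₂[uStat h (fun i => X i ω) n, uStat k (fun i => X i ω) n] -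
          !₂[theta P X h, theta P X k]) := by
    have h1 := measurable_uStat hmeas hh n
    have h2 := measurable_uStat hmeas hk n
    have hv : Measurable fun ω =>
        !₂[uStat h (fun i => X i ω) n, uStat k (fun i => X i ω) n] := by
      refine (WithLp.measurable_toLp 2 _).comp (measurable_pi_iff.2 fun i => ?_)
      fin_cases i <;> simpa
    exact (hv.sub_const _).const_smul (√(n : ℝ))
  refine ⟨fun n => (hVm n).aemeasurable, by fun_prop, ?_⟩
  refine ProbabilityMeasure.tendsto_iff_tendsto_charFun.2 fun t => ?_
  have h1d := tendstoInDistribution_uStat hmeas hindep hident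
    (measurable_linear hh hk (t 0) (t 1)) (fun x y => by rw [hsymm x y, ksymm x y])
    (abs_linear_le hC hD (t 0) (t 1))
  -- The characteristic function of a random vector at `t` is that of its inner product with `t` at
  -- `1`.
  have hcf := ProbabilityMeasure.tendsto_iff_tendsto_charFun.1 h1d.tendsto 1
  have heta := eta_linear (P := P) hmeas hh hk hC hD t
  -- Nonnegativity makes the `toNNReal` in the scalar variance harmless.
  have heta0 : 0 ≤ eta P X fun y z => t 0 * h y z + t 1 * k y z :=
    integral_nonneg fun ω => sq_nonneg _
  simp only [ProbabilityMeasure.coe_mk, Measure.map_id, charFun_gaussianReal] at hcf ⊢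
  rw [charFun_multivariateGaussian hS, Matrix.smul_mulVec, dotProduct_smul, ← heta]
  convert hcf using 2 with n
  · rw [charFun_apply, charFun_apply, integral_map (hVm n).aemeasurable (by fun_prop),
      integral_map (h1d.forall_aemeasurable n) (by fun_prop)]
    refine integral_congr_ae (ae_of_all _ fun ω => ?_)
    simp only [uStat_linear, theta_linear hmeas hh hk hC hD]
    congr 3
    simp [PiLp.inner_apply, Fin.sum_univ_two]
    ring
  · simp [Real.coe_toNNReal _ (mul_nonneg zero_le_four heta0)]

end CramerWold

/-! ### Changing kernels off the positive quadrant -/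

section Transfer

variable {Ω : Type*} [MeasurableSpace Ω] {P : Measure Ω} {X : ℕ → Ω → ℝ} {h k : ℝ → ℝ → ℝ}

lemma theta_congr (hpos : ∀ i, ∀ᵐ ω ∂P, 0 < X i ω)
    (hhk : ∀ x y, 0 < x → 0 < y → h x y = k x y) : theta P X h = theta P X k := by
  refine integral_congr_ae ?_
  filter_upwards [hpos 0, hpos 1] with ω h0 h1 using hhk _ _ h0 h1

lemma psiOne_congr (hpos : ∀ i, ∀ᵐ ω ∂P, 0 < X i ω)
    (hhk : ∀ x y, 0 < x → 0 < y → h x y = k x y) {x : ℝ} (hx : 0 < x) :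
    psiOne P X h x = psiOne P X k x := by
  refine integral_congr_ae ?_
  filter_upwards [hpos 1] with ω h1
  rw [psi, psi, hhk _ _ hx h1, theta_congr hpos hhk]

lemma covMatrix_congr {h' k' : ℝ → ℝ → ℝ} (hpos : ∀ i, ∀ᵐ ω ∂P, 0 < X i ω)
    (hh : ∀ x y, 0 < x → 0 < y → h x y = h' x y) (hk : ∀ x y, 0 < x → 0 < y → k x y = k' x y) :
    covMatrix P X h k = covMatrix P X h' k' := by
  have e1 : eta P X h = eta P X h' := by
    refine integral_congr_ae ?_
    filter_upwards [hpos 0] with ω h0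
    rw [psiOne_congr hpos hh h0]
  have e2 : eta P X k = eta P X k' := by
    refine integral_congr_ae ?_
    filter_upwards [hpos 0] with ω h0
    rw [psiOne_congr hpos hk h0]
  have e3 : etaCross P X h k = etaCross P X h' k' := by
    refine integral_congr_ae ?_
    filter_upwards [hpos 0] with ω h0
    rw [psiOne_congr hpos hh h0, psiOne_congr hpos hk h0]
  rw [covMatrix, covMatrix, e1, e2, e3]

lemma uStat_congr {x : ℕ → ℝ} (hx : ∀ i, 0 < x i)
    (hhk : ∀ x y, 0 < x → 0 < y → h x y = k x y) (n : ℕ) : uStat h x n = uStat k x n := by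
  simp only [uStat, hhk _ _ (hx _) (hx _)]

end Transfer

/-! ### Symmetry, measurability and bounds for the two kernels -/

section Kernels

variable {d : ℝ}

lemma kernel₁_symm (x y : ℝ) : kernel₁ d x y = kernel₁ d y x := by
  simp only [kernel₁, abs_sub_comm x y, add_comm x y]

lemma kernel₂_symm (x y : ℝ) : kernel₂ d x y = kernel₂ d y x := by
  simp only [kernel₂, add_comm x y]

lemma measurable_kernel₂ : Measurable (Function.uncurry (kernel₂ d)) :=
  Measurable.ite (measurableSet_lt measurable_const (measurable_fst.add measurable_snd))
    measurable_const measurable_const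

lemma measurable_kernel₁ : Measurable (Function.uncurry (kernel₁ d)) := by
  have : Measurable fun p : ℝ × ℝ => |p.1 - p.2| / (p.1 + p.2) := by fun_prop
  exact this.mul measurable_kernel₂

lemma abs_kernel₂_le (x y : ℝ) : |kernel₂ d x y| ≤ 1 := by
  unfold kernel₂
  split_ifs <;> simp

/-- For nonnegative arguments `|x - y| ≤ x + y`; arguments of opposite signs can make the quotient
arbitrarily large. -/
lemma abs_kernel₁_le {x y : ℝ} (hx : 0 ≤ x) (hy : 0 ≤ y) : |kernel₁ d x y| ≤ 1 := by
  have hq : |x - y| / (x + y) ≤ 1 :=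
    div_le_one_of_le₀ (abs_le.2 ⟨by linarith, by linarith⟩) (by linarith)
  have hq0 : 0 ≤ |x - y| / (x + y) := by positivity
  unfold kernel₁
  split_ifs
  · rw [mul_one, abs_of_nonneg hq0]; exact hq
  · simp

end Kernels

end GammaTail

theorem proposition4 {Ω : Type*} [MeasurableSpace Ω] (P : Measure Ω) [IsProbabilityMeasure P]
    (X : ℕ → Ω → ℝ) (hmeas : ∀ i, Measurable (X i))
    (hindep : iIndepFun X P) (hident : ∀ i, IdentDistrib (X i) (X 0) P P)
    (hpos : ∀ i, ∀ᵐ ω ∂P, 0 < X i ω) (hpdf : HasPDF (X 0) P volume)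
    (d : ℝ) (hd : 0 ≤ d)
    (hη₁ : 0 < GammaTail.eta P X (GammaTail.kernel₁ d))
    (hη₂ : 0 < GammaTail.eta P X (GammaTail.kernel₂ d)) :
    (GammaTail.sigmaMatrix P X d).PosSemidef ∧
    TendstoInDistribution
      (fun (n : ℕ) (ω : Ω) =>
        Real.sqrt n •
          (!₂[GammaTail.uStat (GammaTail.kernel₁ d) (fun i => X i ω) n,
              GammaTail.uStat (GammaTail.kernel₂ d) (fun i => X i ω) n] -
           !₂[GammaTail.theta P X (GammaTail.kernel₁ d),
              GammaTail.theta P X (GammaTail.kernel₂ d)]))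
      atTop
      (id : EuclideanSpace ℝ (Fin 2) → EuclideanSpace ℝ (Fin 2))
      (fun _ => P)
      (multivariateGaussian 0 ((4 : ℝ) • GammaTail.sigmaMatrix P X d)) := by
  open GammaTail in
  -- On the positive half-line `kernel₁ d` agrees with a kernel that is bounded everywhere.
  let h : ℝ → ℝ → ℝ := fun x y => kernel₁ d |x| |y|
  have hh : Measurable (Function.uncurry h) := measurable_kernel₁.comp
    (f := fun p : ℝ × ℝ => (|p.1|, |p.2|)) (by fun_prop)
  have hC (x y : ℝ) : |h x y| ≤ 1 := abs_kernel₁_le (abs_nonneg x) (abs_nonneg y)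
  have hk := measurable_kernel₂ (d := d)
  have hD := abs_kernel₂_le (d := d)
  have heq (x y : ℝ) (hx : 0 < x) (hy : 0 < y) : h x y = kernel₁ d x y := by
    simp only [h, abs_of_pos hx, abs_of_pos hy]
  have hcov : covMatrix P X h (kernel₂ d) = sigmaMatrix P X d :=
    covMatrix_congr hpos heq fun _ _ _ _ => rfl
  have hclt := tendstoInDistribution_uStat_pair hmeas hindep hident hh hk
    (fun x y => kernel₁_symm _ _) kernel₂_symm hC hD
  have hpsd := posSemidef_covMatrix (P := P) hmeas hh hk hC hD
  simp only [hcov] at hclt hpsd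
  refine ⟨hpsd, hclt.congr (fun n => ?_) (ae_eq_refl _)⟩
  -- Countably many null sets are discarded at once, so the whole sample path is positive.
  filter_upwards [ae_all_iff.2 hpos] with ω hω
  simp only [uStat_congr hω heq, theta_congr hpos heq]
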